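/- A composite positive integer $m$ has the Lehmer property if $\varphi(m)\mid m-1$, where $\varphi$ is Euler's totient function; $\nu_2(k)$ denotes the exponent of $2$ in the prime factorization of the positive integer $k$. For every real number $L\ge 1$, only finitely many numbers in the set $$ R(L)=\left\{\frac{g^{n}-1}{g-1}\ \bigg|\ g,n\in\mathbb{N},\ g\ge 2,\ n\ge 1,\ \nu_{2}(g)+\nu_{2}(g+1)\leq L \right\} $$ have the Lehmer property, and all of them are effectively computable: there is a computable function that, for every real $L\ge 1$, given the integer $\lfloor L\rfloor$ (on which alone $R(L)$ depends), outputs a finite list whose members are exactly the numbers in $R(L)$ with the Lehmer property. -/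

import Mathlib

/-- A composite positive integer `m` has the Lehmer property if `φ(m)` divides `m - 1`. -/
def HasLehmerProperty (m : ℕ) : Prop :=
  1 < m ∧ ¬ m.Prime ∧ Nat.totient m ∣ m - 1

/-- The repunit numbers `(g ^ n - 1) / (g - 1)`, with base `g ≥ 2` and length `n ≥ 1`, such that
`ν₂(g) + ν₂(g + 1) ≤ L`. For `g ≥ 2` the subtractions and the division are exact in `ℕ`. -/
def repunitSet (L : ℝ) : Set ℕ :=
  {m | ∃ g n : ℕ, 2 ≤ g ∧ 1 ≤ n ∧
    (padicValNat 2 g : ℝ) + (padicValNat 2 (g + 1) : ℝ) ≤ L ∧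
    m = (g ^ n - 1) / (g - 1)}

/-! Let m = 1 + g + ⋯ + g^(n-1) be a Lehmer number and C = 2^l. Since m is odd and squarefree,
2^ω(m) divides m - 1 = g(1 + ⋯ + g^(n-2)), and the bound on ν₂(g) + ν₂(g+1) gives 2^ω(m) ≤ C(n-1).
On the other side, 4m ≤ (4N)^(2^ω(m/N)) for each divisor N (`four_mul_le`). Together, g^(2^ω(N)) ≤
(4N)^C (`divisorsGrow`); N = 1 bounds g.

To bound n, take a proper divisor d of n and N = `repunit g d`. The cofactor m/N has a prime p
bounded in terms of d, and lcm(d, ord_p g) is a larger divisor of n, again bounded. This builds a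
chain of divisors of n, all multiples of one prime q. Each divisor of n that is a multiple of q is
the order of g modulo some prime of m, which is then 1 mod q, so m - 1 gains a factor q. As q ∣ n,
the q-part of m - 1 is at most g^q, so the chain soon reaches n.

All bounds are primitive recursive, so a bounded search computes the list. -/

/-! ### Elementary constraints on Lehmer numbers -/

theorem HasLehmerProperty.squarefree {m : ℕ} (h : HasLehmerProperty m) : Squarefree m := by
  rw [Nat.squarefree_iff_prime_squarefree]
  rintro p hp ⟨c, hc⟩
  have h1 : p ∣ m.totient := by
    rw [hc, mul_assoc, Nat.totient_mul_of_prime_of_dvd hp ⟨p * c / p, by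
      rw [Nat.mul_div_cancel_left _ hp.pos]⟩]
    exact dvd_mul_right _ _
  have h2 : p ∣ m - 1 := h1.trans h.2.2
  have h3 : p ∣ m := ⟨p * c, by rw [hc, mul_assoc]⟩
  have h4 : p ∣ 1 := by
    have := Nat.dvd_sub h3 h2
    rwa [Nat.sub_sub_self h.1.le] at this
  exact hp.one_lt.ne' (Nat.dvd_one.mp h4)

theorem HasLehmerProperty.odd {m : ℕ} (h : HasLehmerProperty m) : Odd m := by
  have h2 : 2 < m := by
    rcases eq_or_lt_of_le (Nat.succ_le_of_lt h.1) with h2 | h2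
    · exact absurd (h2 ▸ Nat.prime_two) h.2.1
    · exact h2
  have h3 : Even (m - 1) := by
    rw [even_iff_two_dvd]
    exact (even_iff_two_dvd.mp (Nat.totient_even h2)).trans h.2.2
  have := h3.add_one
  rwa [Nat.sub_add_cancel h.1.le] at this

/-- A set of prime factors of `m` that are all `1` modulo `q` contributes a power of `q` to
`m - 1`. -/
theorem HasLehmerProperty.pow_card_dvd {m : ℕ} (h : HasLehmerProperty m) {q : ℕ} {S : Finset ℕ}
    (hS : S ⊆ m.primeFactors) (hq : ∀ p ∈ S, q ∣ p - 1) : q ^ S.card ∣ m - 1 := by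
  have h1 : q ^ S.card ∣ ∏ p ∈ S, (p - 1) := by
    rw [← Finset.prod_const]
    exact Finset.prod_dvd_prod_of_dvd _ _ hq
  have h2 : ∏ p ∈ S, (p - 1) ∣ ∏ p ∈ m.primeFactors, (p - 1) :=
    Finset.prod_dvd_prod_of_subset _ _ _ hS
  have h3 : ∏ p ∈ m.primeFactors, (p - 1) ∣ m.totient := by
    rw [Nat.totient_eq_div_primeFactors_mul]
    exact dvd_mul_left _ _
  exact ((h1.trans h2).trans h3).trans h.2.2

theorem HasLehmerProperty.not_dvd_of_dvd_sub_one {m : ℕ} (h : HasLehmerProperty m) {p r : ℕ}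
    (hr : r.Prime) (hp : p.Prime) (hpm : p ∣ m) (hrp : r ∣ p - 1) : r ∣ m - 1 ∧ ¬ r ∣ m := by
  have h1 : r ∣ m - 1 := by
    have := h.pow_card_dvd (q := r) (S := {p})
      (by simpa using ⟨hp, hpm, (by have := h.1; omega)⟩) (by simpa using hrp)
    simpa using this
  refine ⟨h1, fun h2 => hr.one_lt.ne' (Nat.dvd_one.mp ?_)⟩
  have := Nat.dvd_sub h2 h1
  rwa [Nat.sub_sub_self h.1.le] at this

/-- Write m - 1 = k φ(N) φ(M), with k ≥ 2 because m is composite. If k φ(N) ≤ N, then φ(M) ≤ M - 1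
forces N = 1 and k ≤ 1. So N + 1 ≤ k φ(N). -/
theorem HasLehmerProperty.succ_mul_totient_lt {m N M : ℕ} (h : HasLehmerProperty m)
    (hNM : N * M = m) (hM : 1 < M) : (N + 1) * M.totient < N * M := by
  have hcop : N.Coprime M := Nat.coprime_of_squarefree_mul (hNM ▸ h.squarefree)
  obtain ⟨k, hk⟩ := h.2.2
  have hm := h.1
  have hN : 0 < N := by
    rcases Nat.eq_zero_or_pos N with rfl | hN
    · simp at hNM; omega
    · exact hN
  have hφ : m.totient = N.totient * M.totient := by rw [← hNM, Nat.totient_mul hcop]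
  have hk2 : 2 ≤ k := by
    have h1 : m.totient < m - 1 := by
      have h2 := Nat.totient_lt m hm
      rcases eq_or_lt_of_le (Nat.le_sub_one_of_lt h2) with h3 | h3
      · exact absurd (Nat.totient_eq_iff_prime (by omega) |>.mp h3) h.2.1
      · exact h3
    by_contra hlt
    interval_cases k <;> omega
  have hMt : M.totient ≤ M - 1 := Nat.le_sub_one_of_lt (Nat.totient_lt M hM)
  have hMpos : 0 < M.totient := Nat.totient_pos.mpr (by omega)
  have key : N * M = k * N.totient * M.totient + 1 := by
    have : m = m.totient * k + 1 := by omega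
    rw [hNM, this, hφ]; ring
  have hlt : N < k * N.totient := by
    by_contra hle
    push Not at hle
    have h1 : k * N.totient * M.totient ≤ N * (M - 1) := Nat.mul_le_mul hle hMt
    have h2 : N * (M - 1) + N = N * M := by
      obtain ⟨M', rfl⟩ := Nat.exists_eq_add_of_lt hM
      simp; ring
    have h3 : N = 1 := by omega
    subst h3
    simp at hle; omega
  nlinarith [Nat.mul_le_mul_right M.totient (Nat.succ_le_of_lt hlt)]

/-! ### Small prime factors of a cofactor -/

/-- The filter cardinality is the rank of P in S, so this is comparison with a geometric series. -/
theorem sum_inv_le_of_rank_lt {N : ℕ} (hN : 0 < N) (S : Finset ℕ)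
    (hS : ∀ P ∈ S, 2 ^ ((S.filter (· ≤ P)).card + 1) * N < P) :
    ∑ P ∈ S, (1 / P : ℝ) ≤ 1 / (2 * N) * (1 - (1 / 2) ^ S.card) := by
  induction S using Finset.induction_on_max with
  | empty => simp
  | insert a s ha ih =>
    have hnot : a ∉ s := fun h => lt_irrefl _ (ha a h)
    rw [Finset.sum_insert hnot, Finset.card_insert_of_notMem hnot]
    have h1 : ∑ P ∈ s, (1 / P : ℝ) ≤ 1 / (2 * N) * (1 - (1 / 2) ^ s.card) := by
      apply ih
      intro P hP
      have := hS P (Finset.mem_insert_of_mem hP)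
      rwa [Finset.filter_insert, if_neg (not_le.mpr (ha P hP))] at this
    have h2 := hS a (Finset.mem_insert_self _ _)
    rw [Finset.filter_true_of_mem, Finset.card_insert_of_notMem hnot] at h2
    · have h3 : (2 ^ (s.card + 1 + 1) * N : ℝ) < a := by exact_mod_cast h2
      have hNr : (0 : ℝ) < N := by exact_mod_cast hN
      have h4 : (1 / a : ℝ) ≤ 1 / (2 ^ (s.card + 1 + 1) * N) :=
        one_div_le_one_div_of_le (by positivity) h3.le
      have h5 : (1 : ℝ) / (2 ^ (s.card + 1 + 1) * N) = 1 / (2 * N) * (1 / 2) ^ (s.card + 1) := by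
        rw [one_div_pow]; field_simp; ring
      rw [h5] at h4
      have h6 : ((1 : ℝ) / 2) ^ s.card = 2 * (1 / 2) ^ (s.card + 1) := by rw [pow_succ]; ring
      rw [h6] at h1
      linarith
    · intro x hx
      rcases Finset.mem_insert.mp hx with rfl | hx
      · exact le_rfl
      · exact (ha x hx).le

theorem one_sub_sum_inv_le_prod {S : Finset ℕ} (hS : ∀ p ∈ S, 1 ≤ p) :
    1 - ∑ p ∈ S, (1 / p : ℝ) ≤ ∏ p ∈ S, (1 - 1 / p : ℝ) := by
  induction S using Finset.induction_on with
  | empty => simp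
  | insert a s ha ih =>
    rw [Finset.sum_insert ha, Finset.prod_insert ha]
    have h1 := ih fun p hp => hS p (Finset.mem_insert_of_mem hp)
    have ha1 : (1 : ℝ) ≤ a := by exact_mod_cast hS a (Finset.mem_insert_self _ _)
    have h2 : (0 : ℝ) ≤ 1 - 1 / a := by
      rw [sub_nonneg]; exact div_le_one_of_le₀ ha1 (by positivity)
    have h3 : (0 : ℝ) ≤ 1 / a := by positivity
    have h4 : (0 : ℝ) ≤ ∑ p ∈ s, (1 / p : ℝ) := Finset.sum_nonneg fun p _ => by positivity
    nlinarith [mul_le_mul_of_nonneg_left h1 h2, mul_nonneg h3 h4]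

/-- Otherwise the reciprocals of the primes of M sum to at most 1/(2N), so φ(M)/M ≥ 1 - 1/(2N),
against φ(M)/M < N/(N+1). -/
theorem HasLehmerProperty.exists_prime_le {m N M : ℕ} (h : HasLehmerProperty m)
    (hNM : N * M = m) (hM : 1 < M) :
    ∃ P ∈ M.primeFactors, P ≤ 2 ^ ((M.primeFactors.filter (· ≤ P)).card + 1) * N := by
  by_contra! hcon
  have hm := h.1
  have hN : 0 < N := by
    rcases Nat.eq_zero_or_pos N with rfl | hN
    · simp at hNM; omega
    · exact hN
  have h1 := sum_inv_le_of_rank_lt hN _ hcon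
  have h2 : 1 - ∑ p ∈ M.primeFactors, (1 / p : ℝ) ≤ ∏ p ∈ M.primeFactors, (1 - 1 / p : ℝ) :=
    one_sub_sum_inv_le_prod fun p hp => (Nat.prime_of_mem_primeFactors hp).one_le
  have h3 : (M.totient : ℝ) = M * ∏ p ∈ M.primeFactors, (1 - 1 / p : ℝ) := by
    have := Nat.totient_eq_mul_prod_factors M
    have h4 := congrArg (fun x : ℚ => (x : ℝ)) this
    push_cast at h4
    simpa using h4
  have h5 : ((N + 1) * M.totient : ℝ) < N * M := by
    exact_mod_cast h.succ_mul_totient_lt hNM hM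
  have hNr : (1 : ℝ) ≤ N := by exact_mod_cast hN
  have hMr : (0 : ℝ) < M := by exact_mod_cast (by omega : 0 < M)
  have h6 : (1 : ℝ) / (2 * N) * (1 - (1 / 2) ^ M.primeFactors.card) ≤ 1 / (2 * N) := by
    have h7 : (0 : ℝ) ≤ 1 / (2 * N) := by positivity
    have h8 : (0 : ℝ) ≤ (1 / 2) ^ M.primeFactors.card := by positivity
    nlinarith [mul_nonneg h7 h8]
  have h9 : (1 : ℝ) - 1 / (2 * N) ≤ ∏ p ∈ M.primeFactors, (1 - 1 / p : ℝ) := by linarith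
  have h10 : (N + 1 : ℝ) * (1 - 1 / (2 * N)) < N := by
    have : (N + 1 : ℝ) * (M * (1 - 1 / (2 * N))) < N * M := by
      refine lt_of_le_of_lt ?_ h5
      rw [h3]; gcongr
    nlinarith
  have h11 : (N + 1 : ℝ) * (1 - 1 / (2 * N)) = N + 1 - (N + 1) / (2 * N) := by field_simp
  have h12 : (N + 1 : ℝ) / (2 * N) ≤ 1 := by rw [div_le_one (by positivity)]; linarith
  linarith

/-- Q is the product of the primes of M up to the P of `exists_prime_le`; the rank of P is then the
number of primes of Q. -/
theorem HasLehmerProperty.exists_small_factor {m N M : ℕ} (h : HasLehmerProperty m)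
    (hNM : N * M = m) (hM : 1 < M) :
    ∃ Q M' : ℕ, M = Q * M' ∧ 1 ≤ Q.primeFactors.card ∧
      M'.primeFactors.card + Q.primeFactors.card = M.primeFactors.card ∧
      ∀ p ∈ Q.primeFactors, p ≤ 2 ^ (Q.primeFactors.card + 1) * N := by
  obtain ⟨P, hP, hPle⟩ := h.exists_prime_le hNM hM
  have hsqM : Squarefree M := h.squarefree.squarefree_of_dvd ⟨N, by rw [← hNM, mul_comm]⟩
  have hprod := Nat.prod_primeFactors_of_squarefree hsqM
  set S := M.primeFactors.filter (· ≤ P) with hS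
  have hSM : S ⊆ M.primeFactors := Finset.filter_subset _ _
  have hQ : (∏ p ∈ S, p).primeFactors = S :=
    Nat.primeFactors_prod fun p hp => Nat.prime_of_mem_primeFactors (hSM hp)
  have hdvd : (∏ p ∈ S, p) ∣ M := by
    conv_rhs => rw [← hprod]
    exact Finset.prod_dvd_prod_of_subset _ _ _ hSM
  obtain ⟨M', hM'⟩ := hdvd
  refine ⟨_, M', hM', ?_, ?_, ?_⟩
  · rw [hQ]
    exact Finset.card_pos.mpr ⟨P, by simpa [hS] using hP⟩
  · have hcop : (∏ p ∈ S, p).Coprime M' := Nat.coprime_of_squarefree_mul (hM' ▸ hsqM)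
    have h1 := hcop.primeFactors_mul
    rw [← hM'] at h1
    rw [h1, Finset.card_union_of_disjoint hcop.disjoint_primeFactors, add_comm]
  · rw [hQ]
    intro p hp
    exact (Finset.mem_filter.mp hp).2.trans hPle

/-! ### The doubly exponential bound -/

theorem le_pow_card_primeFactors {Q B : ℕ} (hQ : Squarefree Q) (h : ∀ p ∈ Q.primeFactors, p ≤ B) :
    Q ≤ B ^ Q.primeFactors.card := by
  conv_lhs => rw [← Nat.prod_primeFactors_of_squarefree hQ]
  exact Finset.prod_le_pow_card _ _ _ h

theorem two_add_mul_succ_le_two_mul_two_pow {i : ℕ} (hi : 1 ≤ i) :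
    2 + i * (i + 1) ≤ 2 * 2 ^ i := by
  induction i, hi using Nat.le_induction with
  | base => norm_num
  | succ i hi ih =>
    rcases eq_or_lt_of_le hi with rfl | hi'
    · norm_num
    · rw [pow_succ]; nlinarith

theorem four_mul_mul_le {N Q i : ℕ} (hN : 0 < N) (hi : 1 ≤ i) (hQ : Q ≤ (2 ^ (i + 1) * N) ^ i) :
    4 * (N * Q) ≤ (4 * N) ^ 2 ^ i := by
  have h1 := two_add_mul_succ_le_two_mul_two_pow hi
  have h2 : i + 1 ≤ 2 ^ i := Nat.lt_two_pow_self
  calc 4 * (N * Q) ≤ 4 * (N * (2 ^ (i + 1) * N) ^ i) := by gcongr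
    _ = 2 ^ (2 + i * (i + 1)) * N ^ (i + 1) := by
        rw [mul_pow, ← pow_mul, pow_add 2 2, pow_succ N, mul_comm (i + 1) i]; ring
    _ ≤ 2 ^ (2 * 2 ^ i) * N ^ 2 ^ i :=
        Nat.mul_le_mul (Nat.pow_le_pow_right (by norm_num) h1) (Nat.pow_le_pow_right hN h2)
    _ = (4 * N) ^ 2 ^ i := by rw [mul_pow, pow_mul]; norm_num

/-- A doubly exponential bound for numbers with the Lehmer property, starting from an arbitrary
divisor `N`. -/
theorem HasLehmerProperty.four_mul_le {m : ℕ} (h : HasLehmerProperty m) :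
    ∀ c N M : ℕ, M.primeFactors.card = c → N * M = m → 4 * m ≤ (4 * N) ^ 2 ^ c := by
  intro c
  induction c using Nat.strong_induction_on with
  | _ c ih =>
    intro N M hc hNM
    have hm := h.1
    have hN : 0 < N := Nat.pos_of_ne_zero (by rintro rfl; simp at hNM; omega)
    have hM0 : 0 < M := Nat.pos_of_ne_zero (by rintro rfl; simp at hNM; omega)
    rcases eq_or_lt_of_le (Nat.succ_le_of_lt hM0) with hM | hM
    · have : M = 1 := hM.symm
      subst this
      simp at hc hNM
      subst hc hNM
      simp
    -- Moving the i primes of Q into N replaces 4N by at most (4N)^(2^i), so the exponents multiply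
    -- to 2^c.
    · obtain ⟨Q, M', hQM, hQ1, hcard, hQle⟩ := h.exists_small_factor hNM hM
      have hQm : Q ∣ m := ⟨N * M', by rw [← hNM, hQM]; ring⟩
      have h1 := ih M'.primeFactors.card (by omega) (N * Q) M' rfl (by rw [← hNM, hQM]; ring)
      have h2 := four_mul_mul_le hN hQ1
        (le_pow_card_primeFactors (h.squarefree.squarefree_of_dvd hQm) hQle)
      calc 4 * m ≤ (4 * (N * Q)) ^ 2 ^ M'.primeFactors.card := h1
        _ ≤ ((4 * N) ^ 2 ^ Q.primeFactors.card) ^ 2 ^ M'.primeFactors.card := by gcongr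
        _ = (4 * N) ^ 2 ^ c := by
          rw [← pow_mul, ← pow_add, ← hc, ← hcard, add_comm]

/-! ### Bounded primes from the growth of divisors -/

/-- The inequality that every divisor `N` of a repunit with the Lehmer property satisfies. -/
def DivisorsGrow (C m : ℕ) : Prop :=
  ∀ N, N ∣ m → 2 ^ 2 ^ N.primeFactors.card ≤ (4 * N) ^ C

theorem succ_pow_three_le (i : ℕ) : (i + 1) ^ 3 ≤ 8 * 2 ^ i := by
  rcases Nat.lt_or_ge i 4 with hi | hi
  · interval_cases i <;> norm_num
  · induction i, hi using Nat.le_induction with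
    | base => norm_num
    | succ i hi ih =>
      have : (i + 1 + 1) ^ 3 ≤ 2 * (i + 1) ^ 3 := by
        obtain ⟨k, rfl⟩ := Nat.exists_eq_add_of_le hi
        ring_nf
        omega
      rw [pow_succ 2]
      omega

theorem le_of_two_pow_le {i C e : ℕ} (h : 2 ^ i ≤ (2 + i * (i + 1 + e)) * C) :
    i + 1 ≤ 8 * C * (e + 2) := by
  have h1 := succ_pow_three_le i
  have h2 : 2 + i * (i + 1 + e) ≤ (i + 1) ^ 2 * (e + 2) := by ring_nf; nlinarith
  have h3 : (i + 1) ^ 2 * (i + 1) ≤ (i + 1) ^ 2 * (8 * C * (e + 2)) := by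
    calc (i + 1) ^ 2 * (i + 1) = (i + 1) ^ 3 := by ring
      _ ≤ 8 * 2 ^ i := h1
      _ ≤ 8 * ((2 + i * (i + 1 + e)) * C) := by gcongr
      _ ≤ 8 * (((i + 1) ^ 2 * (e + 2)) * C) := by gcongr
      _ = _ := by ring
  exact Nat.le_of_mul_le_mul_left h3 (by positivity)

/-- The factor Q with i small primes is at most 2^(i(i+1+e)), while `DivisorsGrow` makes it doubly
exponential in i. Hence i, and with it every prime of Q, is bounded. -/
theorem HasLehmerProperty.exists_bounded_prime {m C e N M : ℕ} (h : HasLehmerProperty m)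
    (hC : DivisorsGrow C m) (hNM : N * M = m) (hM : 1 < M) (he : N ≤ 2 ^ e) :
    ∃ p, p.Prime ∧ p ∣ M ∧ p ≤ 2 ^ (8 * C * (e + 2) + e) := by
  obtain ⟨Q, M', hQM, hQ1, -, hQle⟩ := h.exists_small_factor hNM hM
  have hQm : Q ∣ m := ⟨N * M', by rw [← hNM, hQM]; ring⟩
  obtain ⟨p, hp⟩ := Finset.card_pos.mp hQ1
  refine ⟨p, Nat.prime_of_mem_primeFactors hp, ?_, ?_⟩
  · exact (Nat.dvd_of_mem_primeFactors hp).trans ⟨M', hQM⟩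
  have h1 := le_pow_card_primeFactors (h.squarefree.squarefree_of_dvd hQm) hQle
  have h2 := hC Q hQm
  have h3 := hQle p hp
  set i := Q.primeFactors.card
  have h4 : 2 ^ 2 ^ i ≤ 2 ^ ((2 + i * (i + 1 + e)) * C) := by
    calc 2 ^ 2 ^ i ≤ (4 * Q) ^ C := h2
      _ ≤ (4 * (2 ^ (i + 1) * 2 ^ e) ^ i) ^ C := by
        gcongr
        exact h1.trans (by gcongr)
      _ = 2 ^ ((2 + i * (i + 1 + e)) * C) := by
        rw [← pow_add, ← pow_mul, show 4 = 2 ^ 2 by norm_num, ← pow_add, ← pow_mul,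
          mul_comm i]
  have h5 := le_of_two_pow_le ((Nat.pow_le_pow_iff_right (by norm_num)).mp h4)
  calc p ≤ 2 ^ (i + 1) * N := h3
    _ ≤ 2 ^ (8 * C * (e + 2)) * 2 ^ e := by gcongr; norm_num
    _ = _ := by rw [pow_add]

/-! ### Repunits and the power of 2 in m - 1 -/

/-- The repunit `1 + g + ⋯ + g ^ (n - 1)`. -/
def repunit (g n : ℕ) : ℕ := ∑ i ∈ Finset.range n, g ^ i

theorem repunit_succ (g n : ℕ) : repunit g (n + 1) = repunit g n + g ^ n :=
  Finset.sum_range_succ _ _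

theorem repunit_succ' (g n : ℕ) : repunit g (n + 1) = g * repunit g n + 1 := by
  induction n with
  | zero => simp [repunit]
  | succ n ih =>
    calc repunit g (n + 1 + 1) = repunit g (n + 1) + g ^ (n + 1) := repunit_succ _ _
      _ = g * (repunit g n + g ^ n) + 1 := by rw [ih]; ring
      _ = _ := by rw [← repunit_succ]

theorem sub_one_mul_repunit_add_one {g : ℕ} (hg : 1 ≤ g) (n : ℕ) :
    (g - 1) * repunit g n + 1 = g ^ n := by
  obtain ⟨k, rfl⟩ := Nat.exists_eq_add_of_le' hg
  induction n with
  | zero => simp [repunit]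
  | succ n ih =>
    rw [Nat.add_sub_cancel] at ih ⊢
    rw [repunit_succ, pow_succ, mul_add, add_right_comm, ih]
    ring

theorem sub_one_mul_repunit {g : ℕ} (hg : 1 ≤ g) (n : ℕ) :
    (g - 1) * repunit g n = g ^ n - 1 := by
  have := sub_one_mul_repunit_add_one hg n
  omega

theorem repunit_eq_div {g : ℕ} (hg : 2 ≤ g) (n : ℕ) : repunit g n = (g ^ n - 1) / (g - 1) :=
  Nat.geomSum_eq hg n

theorem repunit_le_pow {g : ℕ} (hg : 2 ≤ g) (n : ℕ) : repunit g n ≤ g ^ n := by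
  rw [repunit_eq_div hg]
  exact (Nat.div_le_self _ _).trans (Nat.sub_le _ _)

theorem pow_le_repunit_succ (g n : ℕ) : g ^ n ≤ repunit g (n + 1) := by
  rw [repunit_succ]; exact Nat.le_add_left _ _

theorem repunit_dvd_repunit {g d n : ℕ} (hg : 2 ≤ g) (h : d ∣ n) : repunit g d ∣ repunit g n := by
  have h1 : g ^ d - 1 ∣ g ^ n - 1 := Nat.pow_sub_one_dvd_pow_sub_one g h
  rw [← sub_one_mul_repunit (by omega), ← sub_one_mul_repunit (by omega)] at h1
  exact Nat.dvd_of_mul_dvd_mul_left (by omega) h1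

theorem repunit_modEq {g r : ℕ} (hg : 1 ≤ g) (h : r ∣ g - 1) (n : ℕ) : repunit g n ≡ n [MOD r] := by
  have h1 : g ≡ 1 [MOD r] := ((Nat.modEq_iff_dvd' hg).mpr h).symm
  induction n with
  | zero => rfl
  | succ n ih =>
    rw [repunit_succ]
    exact ih.add (by simpa using h1.pow n)

/-- For even g only the factor g of m - 1 is even, and a = 0. For odd g, n - 1 is even and lifting
the exponent gives a = ν₂(n-1). -/
theorem two_pow_dvd_bound {g n K l : ℕ} (hg : 2 ≤ g) (hn : 2 ≤ n) (hodd : Odd (repunit g n))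
    (hl : padicValNat 2 g + padicValNat 2 (g + 1) ≤ l) (hK : 2 ^ K ∣ repunit g n - 1) :
    ∃ a, 2 ^ a ≤ n - 1 ∧ K ≤ l + a := by
  obtain ⟨n, rfl⟩ := Nat.exists_eq_add_of_le' (show 1 ≤ n by omega)
  rw [repunit_succ', Nat.add_sub_cancel] at hK
  rcases Nat.even_or_odd g with he | ho
  · refine ⟨0, by simp; omega, ?_⟩
    have h1 : Odd (repunit g n) := by
      obtain ⟨n, rfl⟩ := Nat.exists_eq_add_of_le' (show 1 ≤ n by omega)
      rw [repunit_succ']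
      exact (he.mul_right _).add_one
    have h2 : 2 ^ K ∣ g :=
      ((Nat.coprime_two_left.mpr h1).pow_left K).dvd_of_dvd_mul_right hK
    have := (padicValNat_dvd_iff_le (by omega)).mp h2
    omega
  · have h2g : 2 ∣ g - 1 := by
      obtain ⟨k, rfl⟩ := ho
      simp
    have h1 : 2 ^ K ∣ repunit g n :=
      ((Nat.coprime_two_left.mpr ho).pow_left K).dvd_of_dvd_mul_left hK
    have hn0 : n ≠ 0 := by omega
    have hev : Even n := by
      have h3 := repunit_modEq (by omega) h2g (n + 1)
      have h4 : Odd (n + 1) := by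
        rw [Nat.odd_iff] at hodd ⊢
        rw [Nat.ModEq] at h3
        omega
      exact Nat.not_odd_iff_even.mp fun h => by
        have := h.add_one
        exact Nat.not_odd_iff_even.mpr this h4
    have h5 := padicValNat.pow_two_sub_pow (x := g) (y := 1) (by omega) h2g
      (by rw [← even_iff_two_dvd, Nat.not_even_iff_odd]; exact ho) hn0 hev
    have hpos : repunit g n ≠ 0 := by
      obtain ⟨k, rfl⟩ := Nat.exists_eq_add_of_le' (show 1 ≤ n by omega)
      rw [repunit_succ']; omega
    rw [one_pow, ← sub_one_mul_repunit (by omega), padicValNat.mul (by omega) hpos] at h5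
    have h6 := (padicValNat_dvd_iff_le hpos).mp h1
    refine ⟨padicValNat 2 n, Nat.le_of_dvd (by omega) pow_padicValNat_dvd, by omega⟩

theorem HasLehmerProperty.two_le_length {g n : ℕ} (h : HasLehmerProperty (repunit g n)) :
    2 ≤ n := by
  have := h.1
  by_contra hn
  have hn : n < 2 := by omega
  interval_cases n <;> simp [repunit] at this

/-- Raise g^(n-1) ≤ (4N)^(2^ω(M)) to the power 2^ω(N), use 2^ω(m) ≤ 2^l (n-1), and take (n-1)-th
roots: n drops out. -/
theorem HasLehmerProperty.divisorsGrow {g n l : ℕ} (hg : 2 ≤ g)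
    (h : HasLehmerProperty (repunit g n))
    (hl : padicValNat 2 g + padicValNat 2 (g + 1) ≤ l) {N : ℕ} (hN : N ∣ repunit g n) :
    g ^ 2 ^ N.primeFactors.card ≤ (4 * N) ^ 2 ^ l := by
  have hn := h.two_le_length
  have h2 : 2 ^ (repunit g n).primeFactors.card ∣ repunit g n - 1 := by
    refine h.pow_card_dvd subset_rfl fun p hp => ?_
    have hodd : Odd p := h.odd.of_dvd_nat (Nat.dvd_of_mem_primeFactors hp)
    obtain ⟨k, rfl⟩ := hodd
    simp
  obtain ⟨a, ha, hK⟩ := two_pow_dvd_bound hg hn h.odd hl h2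
  obtain ⟨M, hM⟩ := hN
  have hcop : N.Coprime M := Nat.coprime_of_squarefree_mul (hM ▸ h.squarefree)
  have hcard : (repunit g n).primeFactors.card = N.primeFactors.card + M.primeFactors.card := by
    rw [hM, hcop.primeFactors_mul, Finset.card_union_of_disjoint hcop.disjoint_primeFactors]
  have hN0 : 0 < N := Nat.pos_of_ne_zero (by rintro rfl; have := h.1; simp at hM; omega)
  have h3 := h.four_mul_le _ N M rfl hM.symm
  have h4 : g ^ (n - 1) ≤ (4 * N) ^ 2 ^ M.primeFactors.card := by
    have := pow_le_repunit_succ g (n - 1)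
    rw [Nat.sub_add_cancel (by omega)] at this
    omega
  have h5 : (g ^ 2 ^ N.primeFactors.card) ^ (n - 1) ≤ ((4 * N) ^ 2 ^ l) ^ (n - 1) := by
    calc (g ^ 2 ^ N.primeFactors.card) ^ (n - 1) = (g ^ (n - 1)) ^ 2 ^ N.primeFactors.card := by
          rw [← pow_mul, ← pow_mul, mul_comm]
      _ ≤ ((4 * N) ^ 2 ^ M.primeFactors.card) ^ 2 ^ N.primeFactors.card := by gcongr
      _ = (4 * N) ^ 2 ^ (repunit g n).primeFactors.card := by
          rw [← pow_mul, ← pow_add, hcard, add_comm]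
      _ ≤ (4 * N) ^ (2 ^ l * 2 ^ a) := by
          rw [← pow_add]
          exact Nat.pow_le_pow_right (by omega) (Nat.pow_le_pow_right (by norm_num) hK)
      _ ≤ (4 * N) ^ (2 ^ l * (n - 1)) := by
          exact Nat.pow_le_pow_right (by omega) (by gcongr)
      _ = _ := by rw [pow_mul]
  exact (Nat.pow_le_pow_iff_left (by omega)).mp h5

/-! ### Orders of g modulo the primes of m -/

section Repunit

variable {g n : ℕ}

theorem exists_prime_dvd_repunit_ne {r : ℕ} (hg : 2 ≤ g) (hr : r.Prime)
    (hsq : Squarefree (repunit g r)) : ∃ p, p.Prime ∧ p ∣ repunit g r ∧ p ≠ r := by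
  by_contra! hcon
  have hlt : r < repunit g r := by
    have h1 : ∀ k, k + 2 < repunit g (k + 2) := by
      intro k
      induction k with
      | zero => simp [repunit, Finset.sum_range_succ]; omega
      | succ k ih =>
        rw [repunit_succ]
        have : 0 < g ^ (k + 2) := by positivity
        omega
    obtain ⟨k, rfl⟩ := Nat.exists_eq_add_of_le' hr.two_le
    exact h1 k
  have hsub : (repunit g r).primeFactors ⊆ {r} := fun p hp => by
    simpa using hcon p (Nat.prime_of_mem_primeFactors hp) (Nat.dvd_of_mem_primeFactors hp)
  have h2 : repunit g r ≤ r ^ (repunit g r).primeFactors.card :=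
    le_pow_card_primeFactors hsq fun p hp => (Finset.mem_singleton.mp (hsub hp)).le
  have h3 : (repunit g r).primeFactors.card ≤ 1 := Finset.card_le_card hsub
  have h4 : r ^ (repunit g r).primeFactors.card ≤ r ^ 1 := Nat.pow_le_pow_right hr.pos h3
  rw [pow_one] at h4
  omega

/-- Modulo a prime p ≠ r of `repunit g r` the order of g is r, so r ∣ p - 1. It follows that m is
coprime to n. -/
theorem HasLehmerProperty.prime_dvd_length (hg : 2 ≤ g) (h : HasLehmerProperty (repunit g n))
    {r : ℕ} (hr : r.Prime) (hrn : r ∣ n) :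
    r ∣ repunit g n - 1 ∧ ¬ r ∣ repunit g n := by
  have hd := repunit_dvd_repunit hg hrn
  obtain ⟨p, hp, hpd, hpr⟩ := exists_prime_dvd_repunit_ne hg hr (h.squarefree.squarefree_of_dvd hd)
  refine h.not_dvd_of_dvd_sub_one hr hp (hpd.trans hd) ?_
  have := Fact.mk hp
  have h1 : ¬ p ∣ g - 1 := fun h1 => hpr <|
    (Nat.prime_dvd_prime_iff_eq hp hr).mp <|
      ((repunit_modEq (by omega) h1 r).dvd_iff dvd_rfl).mp hpd
  have h2 : p ∣ g ^ r - 1 := by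
    rw [← sub_one_mul_repunit (by omega)]; exact hpd.mul_left _
  have h3 : (g : ZMod p) ^ r = 1 := by
    have := (ZMod.natCast_eq_zero_iff _ p).mpr h2
    rw [Nat.cast_sub (Nat.one_le_pow _ _ (by omega))] at this
    push_cast at this
    exact sub_eq_zero.mp this
  have h4 : (g : ZMod p) ≠ 1 := by
    intro h4
    apply h1
    rw [← ZMod.natCast_eq_zero_iff, Nat.cast_sub (by omega), h4]; simp
  have := Fact.mk hr
  have h5 : orderOf (g : ZMod p) = r := orderOf_eq_prime h3 h4
  have h6 : (g : ZMod p) ≠ 0 := by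
    intro h6; rw [h6, zero_pow hr.ne_zero] at h3; exact zero_ne_one h3
  rw [← h5]
  exact ZMod.orderOf_dvd_card_sub_one h6

theorem HasLehmerProperty.not_dvd_sub_one (hg : 2 ≤ g) (h : HasLehmerProperty (repunit g n))
    {p : ℕ} (hp : p.Prime) (hpm : p ∣ repunit g n) : ¬ p ∣ g - 1 := fun h1 =>
  (h.prime_dvd_length hg hp (((repunit_modEq (by omega) h1 n).dvd_iff dvd_rfl).mp hpm)).2 hpm

/-- A prime factor of a repunit with the Lehmer property divides exactly the repunits whose length
is a multiple of the order of the base. -/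
theorem HasLehmerProperty.dvd_repunit_iff (hg : 2 ≤ g) (h : HasLehmerProperty (repunit g n))
    {p : ℕ} (hp : p.Prime) (hpm : p ∣ repunit g n) (d : ℕ) :
    p ∣ repunit g d ↔ orderOf (g : ZMod p) ∣ d := by
  rw [orderOf_dvd_iff_pow_eq_one]
  have h1 : p ∣ repunit g d ↔ p ∣ g ^ d - 1 := by
    rw [← sub_one_mul_repunit (by omega), hp.dvd_mul]
    simp [h.not_dvd_sub_one hg hp hpm]
  rw [h1, ← ZMod.natCast_eq_zero_iff, Nat.cast_sub (Nat.one_le_pow _ _ (by omega)), sub_eq_zero]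
  push_cast
  rfl

theorem HasLehmerProperty.orderOf_dvd_sub_one (hg : 2 ≤ g) (h : HasLehmerProperty (repunit g n))
    {p : ℕ} (hp : p.Prime) (hpm : p ∣ repunit g n) : orderOf (g : ZMod p) ∣ p - 1 := by
  have := Fact.mk hp
  refine ZMod.orderOf_dvd_card_sub_one fun h6 => ?_
  have h7 := (h.dvd_repunit_iff hg hp hpm n).mp hpm
  rw [orderOf_dvd_iff_pow_eq_one, h6, zero_pow (by have := h.two_le_length; omega)] at h7
  exact zero_ne_one h7

/-- Any prime factor p of Φ_d(g) works: since m is coprime to n, p ∤ d, so g is a primitive d-th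
root of unity modulo p. -/
theorem HasLehmerProperty.exists_prime_orderOf_eq (hg : 2 ≤ g)
    (h : HasLehmerProperty (repunit g n)) {d : ℕ} (hd : d ∣ n) (hd1 : 1 < d) :
    ∃ p, p.Prime ∧ p ∣ repunit g n ∧ orderOf (g : ZMod p) = d := by
  have hgt := Polynomial.sub_one_pow_totient_lt_cyclotomic_eval (n := d) (q := (g : ℝ)) hd1
    (by exact_mod_cast (by omega : 1 < g))
  have h1 : (1 : ℤ) < (Polynomial.cyclotomic d ℤ).eval (g : ℤ) := by
    have h2 : (1 : ℝ) ≤ (g - 1 : ℝ) ^ d.totient :=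
      one_le_pow₀ (by have : (2 : ℝ) ≤ g := by exact_mod_cast hg
                      linarith)
    have h3 := h2.trans_lt hgt
    have h4 : (Polynomial.cyclotomic d ℝ).eval (g : ℝ)
        = (((Polynomial.cyclotomic d ℤ).eval (g : ℤ) : ℤ) : ℝ) := by
      rw [← Polynomial.map_cyclotomic_int d ℝ]
      have := Polynomial.eval_intCast_map (Int.castRingHom ℝ) (Polynomial.cyclotomic d ℤ) (g : ℤ)
      simpa using this
    rw [h4] at h3
    exact_mod_cast h3
  obtain ⟨p, hp, hpd⟩ := Nat.exists_prime_and_dvd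
    (n := ((Polynomial.cyclotomic d ℤ).eval (g : ℤ)).natAbs) (by omega)
  have hpd' : (p : ℤ) ∣ (Polynomial.cyclotomic d ℤ).eval (g : ℤ) := Int.natCast_dvd.mpr hpd
  have := Fact.mk hp
  have hdvd : (Polynomial.cyclotomic d ℤ).eval (g : ℤ) ∣ (repunit g d : ℤ) := by
    have h5 := Polynomial.cyclotomic_dvd_geom_sum_of_dvd ℤ (dvd_refl d) hd1.ne'
    have h6 := Polynomial.eval_dvd (x := (g : ℤ)) h5
    simpa [repunit, Polynomial.eval_finsetSum] using h6
  have hpm : p ∣ repunit g n :=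
    (Int.natCast_dvd_natCast.mp (hpd'.trans hdvd)).trans (repunit_dvd_repunit hg hd)
  refine ⟨p, hp, hpm, ?_⟩
  have hpn : ¬ p ∣ n := fun hpn => (h.prime_dvd_length hg hp hpn).2 hpm
  have hne : NeZero (d : ZMod p) := ⟨fun h7 => hpn (((ZMod.natCast_eq_zero_iff _ _).mp h7).trans hd)⟩
  have hroot : (Polynomial.cyclotomic d (ZMod p)).IsRoot (g : ZMod p) := by
    rw [Polynomial.IsRoot, ← Polynomial.map_cyclotomic_int d (ZMod p)]
    have := Polynomial.eval_intCast_map (Int.castRingHom (ZMod p)) (Polynomial.cyclotomic d ℤ) (g : ℤ)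
    simp only [Int.cast_natCast] at this
    rw [this]
    simpa using (ZMod.intCast_zmod_eq_zero_iff_dvd _ p).mpr hpd'
  exact (Polynomial.isRoot_cyclotomic_iff.mp hroot).eq_orderOf.symm

/-- The `q`-part of `m - 1` is bounded in terms of `g` and `q` when the prime `q` divides the
length of the repunit `m`. -/
theorem pow_le_of_dvd_repunit_sub_one {q r : ℕ} (hg : 2 ≤ g) (hn : 2 ≤ n) (hq : q.Prime)
    (hqn : q ∣ n) (h : q ^ r ∣ repunit g n - 1) : q ^ r ≤ g ^ q := by
  obtain ⟨n, rfl⟩ := Nat.exists_eq_add_of_le' (show 1 ≤ n by omega)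
  rw [repunit_succ', Nat.add_sub_cancel] at h
  have hqn' : q.Coprime n := by
    rw [hq.coprime_iff_not_dvd]
    intro h1
    exact hq.one_lt.ne' (Nat.dvd_one.mp ((Nat.dvd_add_right h1).mp hqn))
  by_cases hqg : q ∣ g
  · have h1 : q.Coprime (repunit g n) := by
      obtain ⟨k, rfl⟩ := Nat.exists_eq_add_of_le' (show 1 ≤ n by omega)
      rw [repunit_succ', hq.coprime_iff_not_dvd]
      intro h1
      exact hq.one_lt.ne' (Nat.dvd_one.mp ((Nat.dvd_add_right (hqg.mul_right _)).mp h1))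
    have h2 : q ^ r ∣ g := (h1.pow_left r).dvd_of_dvd_mul_right h
    exact (Nat.le_of_dvd (by omega) h2).trans (Nat.le_self_pow hq.ne_zero g)
  · have hcop : q.Coprime g := (hq.coprime_iff_not_dvd).mpr hqg
    have h1 : q ^ r ∣ repunit g n := (hcop.pow_left r).dvd_of_dvd_mul_left h
    have h2 : g ^ n ≡ 1 [MOD q ^ r] := by
      refine ((Nat.modEq_iff_dvd' (Nat.one_le_pow _ _ (by omega))).mpr ?_).symm
      rw [← sub_one_mul_repunit (by omega)]; exact h1.mul_left _
    have h3 : g ^ (q ^ r).totient ≡ 1 [MOD q ^ r] := Nat.ModEq.pow_totient (hcop.pow_left r).symm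
    have h4 : g ^ Nat.gcd n (q ^ r).totient ≡ 1 [MOD q ^ r] := by
      rw [← ZMod.natCast_eq_natCast_iff] at h2 h3 ⊢
      push_cast at h2 h3 ⊢
      exact pow_gcd_eq_one.mpr ⟨h2, h3⟩
    -- Here `n` is the original length minus one, hence prime to q, and the gcd keeps only the q - 1
    -- part of φ(q^r).
    have h5 : Nat.gcd n (q ^ r).totient ∣ q - 1 := by
      rcases Nat.eq_zero_or_pos r with rfl | hr
      · simp
      · rw [Nat.totient_prime_pow hq hr]
        have : (Nat.gcd n (q ^ (r - 1) * (q - 1))).Coprime (q ^ (r - 1)) :=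
          Nat.Coprime.coprime_dvd_left (Nat.gcd_dvd_left _ _) (hqn'.pow_left _).symm
        exact this.dvd_of_dvd_mul_left (Nat.gcd_dvd_right _ _)
    have h6 : q ^ r ∣ g ^ (q - 1) - 1 := by
      rw [← Nat.modEq_iff_dvd' (Nat.one_le_pow _ _ (by omega))]
      obtain ⟨k, hk⟩ := h5
      rw [hk, pow_mul]
      simpa using (h4.pow k).symm
    have h7 : 1 < g ^ (q - 1) := Nat.one_lt_pow (by have := hq.two_le; omega) (by omega)
    calc q ^ r ≤ g ^ (q - 1) - 1 := Nat.le_of_dvd (by omega) h6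
      _ ≤ g ^ (q - 1) := Nat.sub_le _ _
      _ ≤ g ^ q := Nat.pow_le_pow_right (by omega) (Nat.sub_le _ _)

end Repunit

/-! ### The divisor chain and the bound for n -/

/-- If a divisor of the length of a repunit with the Lehmer property is at most `D`, then the next
divisor of the chain is at most `chainStep C D`. -/
def chainStep (C D : ℕ) : ℕ := D * 2 ^ (8 * C * (2 * C * D + 2) + 2 * C * D)

theorem chainStep_mono (C : ℕ) : Monotone (chainStep C) := fun D D' h => by
  unfold chainStep
  gcongr
  norm_num

theorem le_chainStep (C D : ℕ) : D ≤ chainStep C D :=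
  Nat.le_mul_of_pos_right _ (by positivity)

/-- A bound for the length of repunits with the Lehmer property. -/
def lengthBound (C : ℕ) : ℕ := (chainStep C)^[2 * C * chainStep C 1 + 1] 1

/-- A bound for the repunits `(g ^ n - 1) / (g - 1)` with `ν₂(g) + ν₂(g + 1) ≤ l` that have the
Lehmer property. -/
def lehmerBound (l : ℕ) : ℕ := 2 ^ (2 * 2 ^ l * lengthBound (2 ^ l))

section Chain

variable {g n C : ℕ}

/-- By squarefreeness a bounded prime p of the cofactor of `repunit g d` does not divide `repunit g
d`, so ord_p g ∤ d. The next divisor is lcm(d, ord_p g). -/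
theorem HasLehmerProperty.exists_next_divisor (hg : 2 ≤ g) (h : HasLehmerProperty (repunit g n))
    (hC : DivisorsGrow C (repunit g n)) (hgC : g ≤ 2 ^ (2 * C)) {d : ℕ} (hd : d ∣ n)
    (hdn : d ≠ n) : ∃ d', d ∣ d' ∧ d' ∣ n ∧ d < d' ∧ d' ≤ chainStep C d := by
  have hn := h.two_le_length
  have hd0 : 0 < d := Nat.pos_of_dvd_of_pos hd (by omega)
  obtain ⟨M, hM⟩ := repunit_dvd_repunit hg hd
  have hlt : repunit g d < repunit g n := by
    have h1 : d < n := lt_of_le_of_ne (Nat.le_of_dvd (by omega) hd) hdn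
    exact Finset.sum_lt_sum_of_subset (Finset.range_subset_range.mpr h1.le)
      (Finset.mem_range.mpr h1) (by simp) (by positivity) (fun _ _ _ => Nat.zero_le _)
  have hM1 : 1 < M := by
    by_contra hM1
    have : M ≤ 1 := by omega
    have := Nat.mul_le_mul_left (repunit g d) this
    omega
  have hN : repunit g d ≤ 2 ^ (2 * C * d) := by
    rw [pow_mul]
    exact (repunit_le_pow hg d).trans (by gcongr)
  obtain ⟨p, hp, hpM, hple⟩ := h.exists_bounded_prime hC hM.symm hM1 hN
  have hpm : p ∣ repunit g n := hM ▸ hpM.mul_left _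
  have hcop : (repunit g d).Coprime M := Nat.coprime_of_squarefree_mul (hM ▸ h.squarefree)
  have hpd : ¬ p ∣ repunit g d := fun hpd =>
    hp.one_lt.ne' (Nat.dvd_one.mp (hcop ▸ Nat.dvd_gcd hpd hpM))
  rw [h.dvd_repunit_iff hg hp hpm] at hpd
  have hon := (h.dvd_repunit_iff hg hp hpm n).mp hpm
  have hop := Nat.le_of_dvd (by have := hp.two_le; omega) (h.orderOf_dvd_sub_one hg hp hpm)
  set e := orderOf (g : ZMod p)
  have he0 : 0 < e := Nat.pos_of_dvd_of_pos hon (by omega)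
  refine ⟨d.lcm e, Nat.dvd_lcm_left _ _, Nat.lcm_dvd hd hon, ?_, ?_⟩
  · refine lt_of_le_of_ne (Nat.le_of_dvd (Nat.lcm_pos hd0 he0) (Nat.dvd_lcm_left _ _)) fun heq => ?_
    exact hpd (heq ▸ Nat.dvd_lcm_right _ _)
  · exact (Nat.div_le_self _ _).trans (Nat.mul_le_mul_left d (by omega))

/-- Distinct divisors are orders modulo distinct primes, each 1 mod q, so q^card divides m - 1,
whose q-part is at most g^q. -/
theorem HasLehmerProperty.card_divisors_le (hg : 2 ≤ g) (h : HasLehmerProperty (repunit g n))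
    (hgC : g ≤ 2 ^ (2 * C)) {q d : ℕ} (hq : q.Prime) (hqd : q ∣ d) (hd : d ∣ n) :
    (d.divisors.filter (q ∣ ·)).card ≤ 2 * C * q := by
  set T := d.divisors.filter (q ∣ ·)
  have hT : ∀ e ∈ T, e ∣ n ∧ q ∣ e ∧ 1 < e := fun e he => by
    obtain ⟨he1, he2⟩ := Finset.mem_filter.mp he
    have h0 := Nat.pos_of_mem_divisors he1
    exact ⟨(Nat.dvd_of_mem_divisors he1).trans hd, he2,
      hq.one_lt.trans_le (Nat.le_of_dvd h0 he2)⟩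
  choose! P hP hPm hPo using fun e he =>
    h.exists_prime_orderOf_eq hg (hT e he).1 (hT e he).2.2
  have hinj : Set.InjOn P T := fun a ha b hb hab => by
    rw [← hPo a ha, ← hPo b hb, hab]
  have hcard : (T.image P).card = T.card := Finset.card_image_of_injOn hinj
  have h1 : q ^ T.card ∣ repunit g n - 1 := by
    rw [← hcard]
    refine h.pow_card_dvd ?_ ?_
    · intro p hp
      obtain ⟨e, he, rfl⟩ := Finset.mem_image.mp hp
      exact Nat.mem_primeFactors.mpr ⟨hP e he, hPm e he, by have := h.1; omega⟩
    · intro p hp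
      obtain ⟨e, he, rfl⟩ := Finset.mem_image.mp hp
      have := h.orderOf_dvd_sub_one hg (hP e he) (hPm e he)
      rw [hPo e he] at this
      exact (hT e he).2.1.trans this
  have h2 := pow_le_of_dvd_repunit_sub_one hg h.two_le_length hq (hqd.trans hd) h1
  refine (Nat.pow_le_pow_iff_right (a := 2) (by norm_num)).mp ?_
  calc 2 ^ T.card ≤ q ^ T.card := Nat.pow_le_pow_left hq.two_le _
    _ ≤ g ^ q := h2
    _ ≤ (2 ^ (2 * C)) ^ q := by gcongr
    _ = 2 ^ (2 * C * q) := by rw [← pow_mul]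

theorem HasLehmerProperty.length_le (hg : 2 ≤ g) (h : HasLehmerProperty (repunit g n))
    (hC : DivisorsGrow C (repunit g n)) (hgC : g ≤ 2 ^ (2 * C)) : n ≤ lengthBound C := by
  have hn := h.two_le_length
  obtain ⟨d₁, -, hd₁n, hd₁, hd₁le⟩ :=
    h.exists_next_divisor hg hC hgC (one_dvd n) (by omega)
  set q := d₁.minFac
  have hq : q.Prime := Nat.minFac_prime hd₁.ne'
  have hqd₁ : q ∣ d₁ := Nat.minFac_dvd d₁
  have chain : ∀ r, ∃ d, d ∣ n ∧ q ∣ d ∧ d ≤ (chainStep C)^[r + 1] 1 ∧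
      (d = n ∨ r + 1 ≤ (d.divisors.filter (q ∣ ·)).card) := by
    intro r
    induction r with
    | zero =>
      refine ⟨d₁, hd₁n, hqd₁, by simpa using hd₁le, Or.inr ?_⟩
      exact Finset.card_pos.mpr ⟨d₁, by simp [hqd₁]; omega⟩
    | succ r ih =>
      obtain ⟨d, hd, hqd, hle, hor⟩ := ih
      rw [Function.iterate_succ_apply']
      by_cases hdn : d = n
      · exact ⟨d, hd, hqd, hle.trans (le_chainStep _ _), Or.inl hdn⟩
      · obtain ⟨d', hdd', hd'n, hlt, hle'⟩ := h.exists_next_divisor hg hC hgC hd hdn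
        refine ⟨d', hd'n, hqd.trans hdd', hle'.trans (chainStep_mono C hle), Or.inr ?_⟩
        have h1 := hor.resolve_left hdn
        have hd0 : 0 < d := Nat.pos_of_dvd_of_pos hd (by omega)
        have hsub : d.divisors.filter (q ∣ ·) ⊂ d'.divisors.filter (q ∣ ·) := by
          refine Finset.ssubset_iff_of_subset ?_ |>.mpr ⟨d', ?_, ?_⟩
          · exact Finset.filter_subset_filter _ (Nat.divisors_subset_of_dvd (by omega) hdd')
          · simp [hqd.trans hdd']; omega
          · intro hmem
            have := Nat.divisor_le (Finset.mem_filter.mp hmem).1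
            omega
        have := Finset.card_lt_card hsub
        omega
  -- Since q ≤ d₁ ≤ `chainStep C 1`, a chain this long would exceed the 2Cq multiples of q allowed.
  obtain ⟨d, hd, hqd, hle, hor⟩ := chain (2 * C * chainStep C 1)
  rcases hor with rfl | hcard
  · exact hle
  · exfalso
    have h1 := h.card_divisors_le hg hgC hq hqd hd
    have h2 : q ≤ chainStep C 1 := (Nat.le_of_dvd (by omega) hqd₁).trans hd₁le
    have h3 := Nat.mul_le_mul_left (2 * C) h2
    omega

theorem HasLehmerProperty.repunit_le {l : ℕ} (hg : 2 ≤ g) (h : HasLehmerProperty (repunit g n))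
    (hl : padicValNat 2 g + padicValNat 2 (g + 1) ≤ l) : repunit g n ≤ lehmerBound l := by
  have hC : DivisorsGrow (2 ^ l) (repunit g n) := fun N hN =>
    (Nat.pow_le_pow_left hg _).trans (h.divisorsGrow hg hl hN)
  -- The divisor 1 gives g ≤ 4^(2^l).
  have hgC : g ≤ 2 ^ (2 * 2 ^ l) := by
    have := h.divisorsGrow hg hl (one_dvd _)
    rw [pow_mul]
    simpa using this
  have hlen := h.length_le hg hC hgC
  calc repunit g n ≤ g ^ n := repunit_le_pow hg n
    _ ≤ (2 ^ (2 * 2 ^ l)) ^ n := by gcongr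
    _ = 2 ^ (2 * 2 ^ l * n) := by rw [← pow_mul]
    _ ≤ lehmerBound l := by unfold lehmerBound; gcongr; norm_num

end Chain

/-! ### Primitive recursiveness of the test and the bound -/

theorem primrec_pow : Primrec₂ ((· ^ ·) : ℕ → ℕ → ℕ) :=
  Primrec₂.unpaired'.1 Nat.Primrec.pow

theorem primrecRel_dvd : PrimrecRel ((· ∣ ·) : ℕ → ℕ → Prop) :=
  PrimrecRel.of_eq (PrimrecRel.comp₂ Primrec.eq
    (Primrec.nat_mod.comp₂ Primrec₂.right Primrec₂.left) (Primrec₂.const 0))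
    fun _ _ => (Nat.dvd_iff_mod_eq_zero).symm

theorem PrimrecRel.exists_lt_of_primcodable {β : Type*} [Primcodable β] {R : ℕ → β → Prop}
    (hR : PrimrecRel R) : PrimrecRel fun n y => ∃ x < n, R x y :=
  PrimrecRel.of_eq (r := fun n y => ∃ x ∈ List.range n, R x y)
    (hR.exists_mem_list.comp (Primrec.list_range.comp Primrec.fst) Primrec.snd) (by simp)

/-- Coprimality as a bounded search makes φ a primitive recursive count. -/
theorem not_exists_common_divisor_iff {k m : ℕ} (hm : 0 < m) :
    (¬ ∃ x < m + 1, x ∣ m ∧ x ∣ k ∧ x ≠ 1) ↔ m.Coprime k := by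
  constructor
  · intro h
    by_contra hne
    exact h ⟨m.gcd k, Nat.lt_succ_of_le (Nat.gcd_le_left k hm), Nat.gcd_dvd_left _ _,
      Nat.gcd_dvd_right _ _, hne⟩
  · rintro h ⟨x, -, hxm, hxk, hx⟩
    exact hx (Nat.dvd_one.mp (h ▸ Nat.dvd_gcd hxm hxk))

theorem primrec_totient : Primrec Nat.totient := by
  classical
  have h1 : PrimrecRel fun k m : ℕ => ¬ ∃ x < m + 1, x ∣ m ∧ x ∣ k ∧ x ≠ 1 := by
    have h2 : PrimrecRel fun (x : ℕ) (y : ℕ × ℕ) => x ∣ y.2 ∧ x ∣ y.1 ∧ x ≠ 1 :=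
      (primrecRel_dvd.comp₂ Primrec₂.left (Primrec.snd.comp₂ Primrec₂.right)).and
        ((primrecRel_dvd.comp₂ Primrec₂.left (Primrec.fst.comp₂ Primrec₂.right)).and
          (Primrec.eq.comp₂ Primrec₂.left (Primrec₂.const 1)).not)
    have h3 := h2.exists_lt_of_primcodable.comp (Primrec.succ.comp Primrec.snd) (Primrec.id (α := ℕ × ℕ))
    exact h3.not
  refine (Primrec.list_length.comp (h1.listFilter.comp Primrec.list_range Primrec.id)).of_eq
    fun m => ?_
  rw [Nat.totient, ← List.toFinset_card_of_nodup (List.nodup_range.filter _)]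
  congr 1
  ext k
  simp only [List.mem_toFinset, List.mem_filter, List.mem_range, decide_eq_true_eq,
    Finset.mem_filter, Finset.mem_range, id]
  exact and_congr_right fun hk => not_exists_common_divisor_iff (by omega)

/-- A primitive recursive description of the members of `repunitSet l` with the Lehmer property. -/
def LehmerRepunitTest (m l : ℕ) : Prop :=
  1 < m ∧ (∃ x < m, 1 < x ∧ x ∣ m) ∧ m.totient ∣ m - 1 ∧
    ∃ g < m, 2 ≤ g ∧ ¬ 2 ^ (l + 1) ∣ g * (g + 1) ∧ ∃ n < m + 1, m * (g - 1) + 1 = g ^ n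

theorem primrecRel_lehmerRepunitTest : PrimrecRel LehmerRepunitTest := by
  have hm : Primrec₂ fun m _ : ℕ => m := Primrec₂.left
  have hcomp : PrimrecRel fun m _ : ℕ => ∃ x < m, 1 < x ∧ x ∣ m := by
    have h2 : PrimrecRel fun x m : ℕ => 1 < x ∧ x ∣ m :=
      (Primrec.nat_lt.comp₂ (Primrec₂.const 1) Primrec₂.left).and primrecRel_dvd
    exact h2.exists_lt.comp₂ hm hm
  have hphi : PrimrecRel fun m _ : ℕ => m.totient ∣ m - 1 :=
    primrecRel_dvd.comp₂ (primrec_totient.comp₂ hm)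
      (Primrec.nat_sub.comp₂ hm (Primrec₂.const 1))
  have hlen : PrimrecPred fun y : ℕ × ℕ × ℕ => ∃ n < y.2.1 + 1, y.2.1 * (y.1 - 1) + 1 = y.1 ^ n := by
    have h2 : PrimrecRel fun (n : ℕ) (y : ℕ × ℕ × ℕ) => y.2.1 * (y.1 - 1) + 1 = y.1 ^ n :=
      Primrec.eq.comp₂
        ((Primrec.succ.comp (Primrec.nat_mul.comp (Primrec.fst.comp Primrec.snd)
          (Primrec.nat_sub.comp Primrec.fst (Primrec.const 1)))).comp₂ Primrec₂.right)
        (primrec_pow.comp₂ (Primrec.fst.comp₂ Primrec₂.right) Primrec₂.left)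
    have h3 := h2.exists_lt_of_primcodable.comp (Primrec.succ.comp (Primrec.fst.comp Primrec.snd))
      (Primrec.id (α := ℕ × ℕ × ℕ))
    exact h3
  have hbase : PrimrecRel fun (g : ℕ) (y : ℕ × ℕ) => 2 ≤ g ∧ ¬ 2 ^ (y.2 + 1) ∣ g * (g + 1) ∧
      ∃ n < y.1 + 1, y.1 * (g - 1) + 1 = g ^ n :=
    (Primrec.nat_le.comp₂ (Primrec₂.const 2) Primrec₂.left).and
      ((primrecRel_dvd.comp₂
        (primrec_pow.comp₂ (Primrec₂.const 2)
          (Primrec.succ.comp₂ (Primrec.snd.comp₂ Primrec₂.right)))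
        (Primrec.nat_mul.comp₂ Primrec₂.left (Primrec.succ.comp₂ Primrec₂.left))).not.and hlen)
  have hrep := hbase.exists_lt_of_primcodable.comp Primrec.fst (Primrec.id (α := ℕ × ℕ))
  exact (Primrec.nat_lt.comp₂ (Primrec₂.const 1) hm).and (hcomp.and (hphi.and hrep))

theorem primrec_chainStep : Primrec₂ chainStep := by
  have h2C : Primrec₂ fun C _ : ℕ => 2 * C :=
    Primrec.nat_mul.comp₂ (Primrec₂.const 2) Primrec₂.left
  have h8C : Primrec₂ fun C _ : ℕ => 8 * C :=
    Primrec.nat_mul.comp₂ (Primrec₂.const 8) Primrec₂.left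
  have he : Primrec₂ fun C D : ℕ => 2 * C * D := Primrec.nat_mul.comp₂ h2C Primrec₂.right
  exact Primrec.nat_mul.comp₂ Primrec₂.right (primrec_pow.comp₂ (Primrec₂.const 2)
    (Primrec.nat_add.comp₂ (Primrec.nat_mul.comp₂ h8C
      (Primrec.nat_add.comp₂ he (Primrec₂.const 2))) he))

theorem primrec_lengthBound : Primrec lengthBound :=
  Primrec.nat_iterate
    (Primrec.succ.comp (Primrec.nat_mul.comp
      (Primrec.nat_mul.comp (Primrec.const 2) Primrec.id)
      (primrec_chainStep.comp Primrec.id (Primrec.const 1))))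
    (Primrec.const 1) primrec_chainStep

theorem primrec_lehmerBound : Primrec lehmerBound := by
  have h : Primrec fun l : ℕ => 2 ^ l := primrec_pow.comp (Primrec.const 2) Primrec.id
  exact primrec_pow.comp (Primrec.const 2) (Primrec.nat_mul.comp
    (Primrec.nat_mul.comp (Primrec.const 2) h) (primrec_lengthBound.comp h))

/-! ### Correctness of the search -/

theorem not_two_pow_dvd_iff {g l : ℕ} (hg : 2 ≤ g) :
    ¬ 2 ^ (l + 1) ∣ g * (g + 1) ↔ padicValNat 2 g + padicValNat 2 (g + 1) ≤ l := by
  rw [padicValNat_dvd_iff_le (by positivity), padicValNat.mul (by omega) (by omega)]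
  omega

theorem mem_repunitSet_iff {L : ℝ} (hL : 1 ≤ L) {m : ℕ} :
    m ∈ repunitSet L ↔ ∃ g n, 2 ≤ g ∧ 1 ≤ n ∧
      padicValNat 2 g + padicValNat 2 (g + 1) ≤ ⌊L⌋₊ ∧ m = repunit g n := by
  refine exists_congr fun g => exists_congr fun n => and_congr_right fun hg =>
    and_congr_right fun _ => and_congr ?_ (by rw [repunit_eq_div hg])
  rw [Nat.le_floor_iff (by linarith)]
  push_cast
  rfl

theorem length_le_repunit {g : ℕ} (hg : 1 ≤ g) (n : ℕ) : n ≤ repunit g n := by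
  simpa [repunit] using
    Finset.card_nsmul_le_sum (Finset.range n) (g ^ ·) 1 fun i _ => Nat.one_le_pow _ _ hg

/-- The search ranges lose nothing: a Lehmer repunit has n ≥ 2, hence g < m, and n ≤ m always. -/
theorem lehmerRepunitTest_iff {L : ℝ} (hL : 1 ≤ L) {m : ℕ} :
    LehmerRepunitTest m ⌊L⌋₊ ↔ m ∈ repunitSet L ∧ HasLehmerProperty m := by
  rw [mem_repunitSet_iff hL]
  constructor
  · rintro ⟨hm, ⟨x, hxm, hx, hxd⟩, hphi, g, hgm, hg, hν, n, -, hn⟩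
    have hprime : ¬ m.Prime := fun hp => by
      rcases (Nat.dvd_prime hp).mp hxd with h | h <;> omega
    refine ⟨⟨g, n, hg, ?_, (not_two_pow_dvd_iff hg).mp hν, ?_⟩, hm, hprime, hphi⟩
    · rcases Nat.eq_zero_or_pos n with rfl | h
      · have : 0 < m * (g - 1) := Nat.mul_pos (by omega) (by omega)
        simp at hn
        omega
      · exact h
    · have h1 := sub_one_mul_repunit_add_one (show 1 ≤ g by omega) n
      have h2 : (g - 1) * m = (g - 1) * repunit g n := by
        rw [mul_comm m] at hn
        omega
      exact Nat.eq_of_mul_eq_mul_left (by omega) h2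
  · rintro ⟨⟨g, n, hg, -, hν, rfl⟩, h⟩
    have hn := h.two_le_length
    refine ⟨h.1, ?_, h.2.2, g, ?_, hg, (not_two_pow_dvd_iff hg).mpr hν, n,
      Nat.lt_succ_of_le (length_le_repunit (by omega) n), ?_⟩
    · have h1 := h.1
      refine ⟨(repunit g n).minFac, ?_, (Nat.minFac_prime h1.ne').one_lt, Nat.minFac_dvd _⟩
      exact (Nat.not_prime_iff_minFac_lt h1).mp h.2.1
    · obtain ⟨k, rfl⟩ := Nat.exists_eq_add_of_le' hn
      have h1 : 1 ≤ repunit g (k + 1) :=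
        (Nat.succ_pos k).trans_le (length_le_repunit (by omega) (k + 1))
      rw [repunit_succ' g (k + 1)]
      exact Nat.lt_succ_of_le (Nat.le_mul_of_pos_right g h1)
    · rw [mul_comm]
      exact sub_one_mul_repunit_add_one (by omega) n

open Classical in
theorem computable_filter_lehmerRepunitTest :
    Computable fun l => (List.range (lehmerBound l + 1)).filter (LehmerRepunitTest · l) :=
  (primrecRel_lehmerRepunitTest.listFilter.comp
    (Primrec.list_range.comp (Primrec.succ.comp primrec_lehmerBound)) Primrec.id).to_comp

theorem le_lehmerBound {L : ℝ} (hL : 1 ≤ L) {m : ℕ} (hm : m ∈ repunitSet L)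
    (h : HasLehmerProperty m) : m ≤ lehmerBound ⌊L⌋₊ := by
  obtain ⟨g, n, hg, -, hν, rfl⟩ := (mem_repunitSet_iff hL).mp hm
  exact h.repunit_le hg hν

theorem corollary5 :
    (∀ L : ℝ, 1 ≤ L → {m : ℕ | m ∈ repunitSet L ∧ HasLehmerProperty m}.Finite) ∧
    ∃ F : ℕ → List ℕ, Computable F ∧
      ∀ L : ℝ, 1 ≤ L → ∀ m : ℕ,
        m ∈ F ⌊L⌋₊ ↔ (m ∈ repunitSet L ∧ HasLehmerProperty m) := by
  classical
  refine ⟨fun L hL => (Set.finite_Iic (lehmerBound ⌊L⌋₊)).subset fun m hm =>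
    le_lehmerBound hL hm.1 hm.2, _, computable_filter_lehmerRepunitTest, fun L hL m => ?_⟩
  rw [List.mem_filter, decide_eq_true_eq, lehmerRepunitTest_iff hL, List.mem_range,
    Nat.lt_succ_iff]
  exact ⟨And.right, fun h => ⟨le_lehmerBound hL h.1 h.2, h⟩⟩
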